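/- Consider a seller of $k\ge 1$ goods and one buyer with an additive valuation $x\in\mathbb{R}_+^k$. A mechanism $\mu=(q,s)$ consists of Borel-measurable functions $q:\mathbb{R}_+^k\to[0,1]^k$ (the allocation) and $s:\mathbb{R}_+^k\to\mathbb{R}_+$ (the payment) such that the buyer payoff $b(x):=q(x)\cdot x-s(x)$ satisfies $b(x)\ge 0$ (individual rationality) and $b(x)\ge q(y)\cdot x-s(y)$ (incentive compatibility) for all $x,y\in\mathbb{R}_+^k$. A $k$-good random valuation is a random variable $X=(X_1,\dots,X_k)$ with values in $\mathbb{R}_+^k$, and the revenue of $\mu$ from $X$ is $R(\mu;X):=\mathbb{E}[s(X)]\in[0,\infty]$. The mechanism $\mu$ is deterministic if $q(x)\in\{0,1\}^k$ for all $x$. A deterministic mechanism is symmetric if its canonical pricing function $p(A):=\sup_{x\in\mathbb{R}_+^k}\bigl(\sum_{i\in A}x_i-b(x)\bigr)\in[0,\infty]$, $A\subseteq\{1,\dots,k\}$, depends only on the size $|A|$ of $A$. Let $\textsc{SymDRev}(X)$ be the supremum of $R(\mu;X)$ over all symmetric deterministic mechanisms $\mu$; let $\textsc{SymSRev}(X)$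 be the supremum of $R(\mu;X)$ over all symmetric separate mechanisms, i.e., those that sell every good separately by one and the same one-good mechanism; and let $\textsc{SRev}(X):=\sum_{i=1}^k\textsc{Rev}(X_i)$, where $\textsc{Rev}(X_i)$ is the supremum of the revenues from $X_i$ of all one-good mechanisms. Put $H(k):=1+\frac12+\dots+\frac1k$. Theorem. For every $k\ge 1$ and every $k$-good random valuation $X$, $$\textsc{SymDRev}(X)\;\le\;2\ln(2k)\,H(k)\cdot\textsc{SymSRev}(X)\;\le\;f(k)\cdot\textsc{SRev}(X),$$ where $f:\mathbb{N}\to\mathbb{R}$ is a function that does not depend on $X$ and satisfies $f(k)=O(\ln^2 k)$ as $k\to\infty$. -/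

import Mathlib

open MeasureTheory
open scoped NNReal ENNReal

noncomputable section

namespace Pricing

/-- A direct mechanism for `k` goods sold to one additive buyer: a Borel-measurable allocation
`q : ℝ₊ᵏ → [0,1]ᵏ` and a Borel-measurable payment `s : ℝ₊ᵏ → ℝ`, satisfying individual rationality,
incentive compatibility and no positive transfers. -/
structure Mechanism (k : ℕ) where
  /-- The allocation function. -/
  q : (Fin k → ℝ≥0) → Fin k → ℝ
  /-- The payment function. -/
  s : (Fin k → ℝ≥0) → ℝ
  measurable_q : Measurable q
  measurable_s : Measurable s
  q_mem : ∀ x i, q x i ∈ Set.Icc (0 : ℝ) 1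
  ir : ∀ x, 0 ≤ ∑ i, q x i * (x i : ℝ) - s x
  ic : ∀ x y, ∑ i, q y i * (x i : ℝ) - s y ≤ ∑ i, q x i * (x i : ℝ) - s x
  npt : ∀ x, 0 ≤ s x

namespace Mechanism

variable {k : ℕ}

/-- The buyer payoff function `b(x) = q(x) · x - s(x)`. -/
def payoff (μ : Mechanism k) (x : Fin k → ℝ≥0) : ℝ :=
  ∑ i, μ.q x i * (x i : ℝ) - μ.s x

/-- Every good is either fully allocated or not allocated at all. -/
def IsDeterministic (μ : Mechanism k) : Prop :=
  ∀ x i, μ.q x i = 0 ∨ μ.q x i = 1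

/-- The canonical deterministic pricing function `p(A) = sup_x (x(A) - b(x))`, which may take the
value `∞`. -/
def canonicalPrice (μ : Mechanism k) (A : Finset (Fin k)) : EReal :=
  ⨆ x : Fin k → ℝ≥0, ((∑ i ∈ A, (x i : ℝ) - μ.payoff x : ℝ) : EReal)

/-- Symmetry of a deterministic mechanism: the price of a set of goods depends only on its size. -/
def IsSymmetric (μ : Mechanism k) : Prop :=
  ∀ A B : Finset (Fin k), A.card = B.card → μ.canonicalPrice A = μ.canonicalPrice B

/-- A symmetric separate mechanism: every good is sold, separately from the others, by one and the
same one-good mechanism. -/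
def IsSymmetricSeparate (μ : Mechanism k) : Prop :=
  ∃ ν : Mechanism 1, ∀ x : Fin k → ℝ≥0,
    (∀ i, μ.q x i = ν.q (fun _ => x i) 0) ∧ μ.s x = ∑ i, ν.s (fun _ => x i)

/-- The expected revenue `R(μ; X) = 𝔼[s(X)]`, as an element of `[0, ∞]` (payments are
nonnegative). -/
def revenue {Ω : Type*} [MeasurableSpace Ω] (μ : Mechanism k) (P : Measure Ω)
    (X : Ω → Fin k → ℝ≥0) : ℝ≥0∞ :=
  ∫⁻ ω, ENNReal.ofReal (μ.s (X ω)) ∂P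

end Mechanism

/-- The maximal revenue over a class of mechanisms. -/
def classRev {k : ℕ} (N : Set (Mechanism k)) {Ω : Type*} [MeasurableSpace Ω] (P : Measure Ω)
    (X : Ω → Fin k → ℝ≥0) : ℝ≥0∞ :=
  ⨆ μ ∈ N, μ.revenue P X

/-- The optimal revenue. -/
def rev {k : ℕ} {Ω : Type*} [MeasurableSpace Ω] (P : Measure Ω) (X : Ω → Fin k → ℝ≥0) : ℝ≥0∞ :=
  classRev Set.univ P X

/-- The separate revenue: the sum of the optimal one-good revenues from `X₁, …, X_k`. -/
def sRev {k : ℕ} {Ω : Type*} [MeasurableSpace Ω] (P : Measure Ω) (X : Ω → Fin k → ℝ≥0) : ℝ≥0∞ :=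
  ∑ i, rev P (fun ω (_ : Fin 1) => X ω i)

/-- The maximal revenue from symmetric separate mechanisms. -/
def symSRev {k : ℕ} {Ω : Type*} [MeasurableSpace Ω] (P : Measure Ω) (X : Ω → Fin k → ℝ≥0) :
    ℝ≥0∞ :=
  classRev {μ | μ.IsSymmetricSeparate} P X

/-- The maximal revenue from symmetric deterministic mechanisms. -/
def symDRev {k : ℕ} {Ω : Type*} [MeasurableSpace Ω] (P : Measure Ω) (X : Ω → Fin k → ℝ≥0) :
    ℝ≥0∞ :=
  classRev {μ | μ.IsDeterministic ∧ μ.IsSymmetric} P X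

end Pricing

end

/-! By symmetry, the prices form one sequence `p 0 = 0, p 1, p 2, ...` independent of the valuation.
Suppose the buyer takes `m` goods, of values `y 0 ≥ y 1 ≥ ...`. Since keeping only the top `j` is no
better, `p m - p j ≤ y j + ... + y (m - 1)`, whence `p m ≤ ∑ min (y i) (p (i + 1))` (`le_sum_min`).
Discarding the part of each term below `p (i + 1) / (2k)` costs at most half of `p m`. So the
payment is at most twice the sum over `j < k` of the length of those `t` in `(p (j + 1) / (2k), p (j
+ 1)]` for which at least `j + 1` goods are worth `t` (`ofReal_s_le`). By Markov, posting the price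
`t` for every good shows that this event has measure at most `SymSRev / (t (j + 1))`. Integrating `1
/ t` gives `log (2k)`, and summing over `j` gives `H(k)`. -/

namespace Pricing

/-- The number of goods whose value is at least `t`. -/
noncomputable def demand {k : ℕ} (t : ℝ) (x : Fin k → ℝ≥0) : ℕ :=
  (Finset.univ.filter fun i => t ≤ (x i : ℝ)).card

/-- Selling each good separately at the posted price `t`. -/
noncomputable def postedPrice (k : ℕ) (t : ℝ) (ht : 0 ≤ t) : Mechanism k where
  q x i := if t ≤ (x i : ℝ) then 1 else 0
  s x := ∑ i, if t ≤ (x i : ℝ) then t else 0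
  measurable_q := by
    refine measurable_pi_lambda _ fun i => ?_
    refine Measurable.ite ?_ measurable_const measurable_const
    exact measurableSet_le measurable_const (by fun_prop)
  measurable_s := by
    refine Finset.measurable_sum _ fun i _ => ?_
    refine Measurable.ite ?_ measurable_const measurable_const
    exact measurableSet_le measurable_const (by fun_prop)
  q_mem x i := by split_ifs <;> simp
  ir x := by
    rw [← Finset.sum_sub_distrib]
    refine Finset.sum_nonneg fun i _ => ?_
    split_ifs with h <;> simp [h]
  ic x y := by
    rw [← Finset.sum_sub_distrib, ← Finset.sum_sub_distrib]
    refine Finset.sum_le_sum fun i _ => ?_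
    split_ifs <;> linarith
  npt x := Finset.sum_nonneg fun i _ => by split_ifs <;> simp [ht]

lemma postedPrice_isSymmetricSeparate (k : ℕ) (t : ℝ) (ht : 0 ≤ t) :
    (postedPrice k t ht).IsSymmetricSeparate :=
  ⟨postedPrice 1 t ht, fun x => by simp [postedPrice]⟩

lemma postedPrice_s (k : ℕ) (t : ℝ) (ht : 0 ≤ t) (x : Fin k → ℝ≥0) :
    (postedPrice k t ht).s x = t * demand t x := by
  simp [postedPrice, demand, ← Finset.sum_filter, mul_comm]

lemma measurable_demand {k : ℕ} :
    Measurable fun z : (Fin k → ℝ≥0) × ℝ => demand z.2 z.1 := by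
  simp only [demand, Finset.card_filter]
  refine Finset.measurable_sum _ fun i _ => ?_
  refine Measurable.ite ?_ measurable_const measurable_const
  exact measurableSet_le (by fun_prop) (by fun_prop)

/-! ### Tail bounds from posted prices. -/

section Revenue

variable {k : ℕ} {Ω : Type*} [MeasurableSpace Ω] {P : Measure Ω} {X : Ω → Fin k → ℝ≥0}

lemma lintegral_demand_le (t : ℝ) (ht : 0 ≤ t) :
    ENNReal.ofReal t * ∫⁻ ω, (demand t (X ω) : ℝ≥0∞) ∂P ≤ symSRev P X := by
  have h : (postedPrice k t ht).revenue P X ≤ symSRev P X :=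
    le_iSup₂ (f := fun (μ : Mechanism k) (_ : μ ∈ {μ : Mechanism k | μ.IsSymmetricSeparate}) =>
      μ.revenue P X) _ (postedPrice_isSymmetricSeparate k t ht)
  refine le_trans (le_of_eq ?_) h
  rw [← lintegral_const_mul' _ _ ENNReal.ofReal_ne_top]
  refine lintegral_congr fun ω => ?_
  rw [postedPrice_s, ENNReal.ofReal_mul ht, ENNReal.ofReal_natCast]

/-- Markov's inequality for the demand, whose mean times `t` is the revenue of the posted price `t`.
-/
lemma measure_demand_ge_le (hX : Measurable X) (j : ℕ) (t : ℝ) (ht : 0 < t) :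
    P {ω | j + 1 ≤ demand t (X ω)} ≤
      ENNReal.ofReal t⁻¹ * (ENNReal.ofReal ((j + 1 : ℝ)⁻¹) * symSRev P X) := by
  have hm : Measurable fun ω => (demand t (X ω) : ℝ≥0∞) :=
    (measurable_from_top (f := fun n : ℕ => (n : ℝ≥0∞))).comp
      (measurable_demand.comp (hX.prodMk measurable_const))
  have h1 := mul_meas_ge_le_lintegral (μ := P) hm ((j + 1 : ℕ) : ℝ≥0∞)
  have h2 := lintegral_demand_le (P := P) (X := X) t ht.le
  have hj : (0 : ℝ) < j + 1 := by positivity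
  simp only [Nat.cast_le] at h1
  have e1 : ENNReal.ofReal t⁻¹ * ENNReal.ofReal t = 1 := by
    rw [← ENNReal.ofReal_mul (by positivity), inv_mul_cancel₀ ht.ne', ENNReal.ofReal_one]
  have e2 : ENNReal.ofReal ((j + 1 : ℝ)⁻¹) * ((j + 1 : ℕ) : ℝ≥0∞) = 1 := by
    rw [← ENNReal.ofReal_natCast, ← ENNReal.ofReal_mul (by positivity)]
    push_cast
    rw [inv_mul_cancel₀ hj.ne', ENNReal.ofReal_one]
  calc P {ω | j + 1 ≤ demand t (X ω)}
      = ENNReal.ofReal t⁻¹ * (ENNReal.ofReal ((j + 1 : ℝ)⁻¹) * (ENNReal.ofReal t *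
          (((j + 1 : ℕ) : ℝ≥0∞) * P {ω | j + 1 ≤ demand t (X ω)}))) := by
        rw [show ∀ a b c d e : ℝ≥0∞, a * (b * (c * (d * e))) = (a * c) * ((b * d) * e) from
          fun a b c d e => by ring, e1, e2, one_mul, one_mul]
    _ ≤ _ := by gcongr; exact (mul_le_mul_right h1 _).trans h2

lemma setLIntegral_inv (a c : ℝ) (ha : 0 ≤ a) (hc : 1 ≤ c) :
    ∫⁻ t in Set.Ioc (a / c) a, ENNReal.ofReal t⁻¹ ≤ ENNReal.ofReal (Real.log c) := by
  rcases ha.eq_or_lt with rfl | ha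
  · simp
  have hc0 : 0 < c := by linarith
  have hac : 0 < a / c := by positivity
  have hle : a / c ≤ a := div_le_self ha.le hc
  have hi : IntervalIntegrable (fun t : ℝ => t⁻¹) volume (a / c) a := by
    refine intervalIntegral.intervalIntegrable_inv (fun t ht => ?_) continuousOn_id
    rw [Set.uIcc_of_le hle] at ht
    exact (hac.trans_le ht.1).ne'
  rw [← ofReal_integral_eq_lintegral_ofReal
    ((intervalIntegrable_iff_integrableOn_Ioc_of_le hle).1 hi),
    ← intervalIntegral.integral_of_le hle, integral_inv_of_pos hac ha]
  · rw [div_div_cancel₀ ha.ne']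
  · refine (ae_restrict_iff' measurableSet_Ioc).2 (ae_of_all _ fun t ht => ?_)
    exact inv_nonneg.2 (hac.trans ht.1).le

/-- Tonelli: the interval of prices does not depend on `ω`, so the tail bound can be applied at each
fixed `t`. -/
lemma lintegral_lintegral_demand_le [SFinite P] (hX : Measurable X) (j : ℕ) (a c : ℝ)
    (ha : 0 ≤ a) (hc : 1 ≤ c) :
    ∫⁻ ω, volume (Set.Ioc (a / c) a ∩ {t | j + 1 ≤ demand t (X ω)}) ∂P ≤
      ENNReal.ofReal (Real.log c) * (ENNReal.ofReal ((j + 1 : ℝ)⁻¹) * symSRev P X) := by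
  have hS : MeasurableSet {z : Ω × ℝ | j + 1 ≤ demand z.2 (X z.1)} :=
    measurableSet_le measurable_const (measurable_demand.comp
      ((hX.comp measurable_fst).prodMk measurable_snd))
  have hc0 : 0 < c := by linarith
  calc ∫⁻ ω, volume (Set.Ioc (a / c) a ∩ {t | j + 1 ≤ demand t (X ω)}) ∂P
      = (P.prod (volume.restrict (Set.Ioc (a / c) a)))
          {z : Ω × ℝ | j + 1 ≤ demand z.2 (X z.1)} := by
        rw [Measure.prod_apply hS]
        refine lintegral_congr fun ω => ?_
        rw [Measure.restrict_apply (measurable_prodMk_left hS), Set.inter_comm]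
        rfl
    _ = ∫⁻ t in Set.Ioc (a / c) a, P {ω | j + 1 ≤ demand t (X ω)} := by
        rw [Measure.prod_apply_symm hS]
        rfl
    _ ≤ ∫⁻ t in Set.Ioc (a / c) a,
          ENNReal.ofReal t⁻¹ * (ENNReal.ofReal ((j + 1 : ℝ)⁻¹) * symSRev P X) := by
        refine setLIntegral_mono (by fun_prop) fun t ht => ?_
        exact measure_demand_ge_le hX j t (lt_of_le_of_lt (by positivity) ht.1)
    _ = (∫⁻ t in Set.Ioc (a / c) a, ENNReal.ofReal t⁻¹) *
          (ENNReal.ofReal ((j + 1 : ℝ)⁻¹) * symSRev P X) :=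
        lintegral_mul_const _ (by fun_prop)
    _ ≤ _ := by gcongr; exact setLIntegral_inv a c ha hc

end Revenue

/-! ### Capped sums and ordered values. -/

/-- If every tail of `y` is worth at least its price increment, then capping each `y i` at the
price `p (i + 1)` still leaves a total of at least `p m`. -/
lemma le_sum_min (p y : ℕ → ℝ) (m : ℕ) (hp0 : p 0 = 0)
    (hy : ∀ i, 0 ≤ y i) (h : ∀ j ≤ m, p m - p j ≤ ∑ i ∈ Finset.Ico j m, y i)
    (hp : ∀ j ≤ m, 0 ≤ p j) :
    p m ≤ ∑ i ∈ Finset.range m, min (y i) (p (i + 1)) := by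
  -- Downward induction on the start of the tail: either the capped tail already reaches `p m`, or
  -- capping has lost nothing. At the last index `j` where the cap binds, `p (j + 1)` plus the
  -- uncapped tail after it reaches `p m`.
  have key : ∀ n ≤ m, p m ≤ ∑ i ∈ Finset.Ico (m - n) m, min (y i) (p (i + 1)) ∨
      ∑ i ∈ Finset.Ico (m - n) m, y i ≤ ∑ i ∈ Finset.Ico (m - n) m, min (y i) (p (i + 1)) := by
    intro n
    induction n with
    | zero => simp
    | succ n ih =>
      intro hn
      obtain ⟨j, hj⟩ : ∃ j, m - (n + 1) = j := ⟨_, rfl⟩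
      have hj' : m - n = j + 1 := by omega
      have hjm : j < m := by omega
      have ih := ih (by omega)
      rw [hj'] at ih
      rw [hj, Finset.sum_eq_sum_Ico_succ_bot hjm, Finset.sum_eq_sum_Ico_succ_bot hjm]
      have h1 := h (j + 1) hjm
      have h2 := hp (j + 1) hjm
      rcases le_total (y j) (p (j + 1)) with hyp | hyp
      · rw [min_eq_left hyp]
        rcases ih with ih | ih
        · left; linarith [hy j]
        · right; linarith
      · rw [min_eq_right hyp]
        left
        rcases ih with ih | ih <;> linarith
  have := key m le_rfl
  have h0 := h 0 (Nat.zero_le _)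
  simp only [Nat.sub_self, ← Finset.range_eq_Ico] at this h0
  rcases this with h' | h' <;> linarith

/-- The values of a finite set of goods, listed in decreasing order. -/
lemma exists_antitone_enum {k : ℕ} (x : Fin k → ℝ≥0) (A : Finset (Fin k)) :
    ∃ e : Fin A.card → Fin k, Function.Injective e ∧ (∀ i, e i ∈ A) ∧
      Antitone fun i => x (e i) := by
  let f : Fin A.card → Fin k := fun i => (A.equivFin.symm i : Fin k)
  let σ := Tuple.sort fun i => OrderDual.toDual (x (f i))
  refine ⟨f ∘ σ, ?_, fun i => (A.equivFin.symm (σ i)).2, ?_⟩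
  · exact (Subtype.val_injective.comp A.equivFin.symm.injective).comp σ.injective
  · exact fun i j hij => Tuple.monotone_sort (fun i => OrderDual.toDual (x (f i))) hij

lemma ofReal_sum_le {ι : Type*} (s : Finset ι) (f : ι → ℝ) :
    ENNReal.ofReal (∑ i ∈ s, f i) ≤ ∑ i ∈ s, ENNReal.ofReal (f i) := by
  classical
  induction s using Finset.induction_on with
  | empty => simp
  | insert a s ha ih =>
    rw [Finset.sum_insert ha, Finset.sum_insert ha]
    exact ENNReal.ofReal_add_le.trans (by gcongr)

/-! ### Canonical prices and the pointwise bound on the payment. -/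

namespace Mechanism

variable {k : ℕ} (μ : Mechanism k)

/-- The set of goods that are allocated with probability one. -/
noncomputable def bought (x : Fin k → ℝ≥0) : Finset (Fin k) :=
  Finset.univ.filter fun i => μ.q x i = 1

variable {μ} in
lemma IsDeterministic.sum_q (hd : μ.IsDeterministic) (x y : Fin k → ℝ≥0) :
    ∑ i, μ.q x i * (y i : ℝ) = ∑ i ∈ μ.bought x, (y i : ℝ) := by
  rw [bought, Finset.sum_filter]
  refine Finset.sum_congr rfl fun i _ => ?_
  rcases hd x i with h | h <;> simp [h]

lemma payoff_nonneg (x : Fin k → ℝ≥0) : 0 ≤ μ.payoff x := μ.ir x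

lemma payoff_zero : μ.payoff 0 = 0 := by
  have h1 := μ.ir 0
  have h2 := μ.npt 0
  simp only [payoff, Pi.zero_apply, NNReal.coe_zero, mul_zero, Finset.sum_const_zero] at *
  linarith

lemma le_canonicalPrice (A : Finset (Fin k)) (x : Fin k → ℝ≥0) :
    ((∑ i ∈ A, (x i : ℝ) - μ.payoff x : ℝ) : EReal) ≤ μ.canonicalPrice A :=
  le_iSup (fun x : Fin k → ℝ≥0 => ((∑ i ∈ A, (x i : ℝ) - μ.payoff x : ℝ) : EReal)) x

lemma canonicalPrice_nonneg (A : Finset (Fin k)) : 0 ≤ μ.canonicalPrice A := by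
  simpa [payoff_zero] using μ.le_canonicalPrice A 0

lemma canonicalPrice_empty : μ.canonicalPrice ∅ = 0 := by
  refine le_antisymm (iSup_le fun x => ?_) (μ.canonicalPrice_nonneg ∅)
  have := μ.payoff_nonneg x
  rw [← EReal.coe_zero, EReal.coe_le_coe_iff]
  simpa using this

lemma canonicalPrice_mono {A B : Finset (Fin k)} (h : A ⊆ B) :
    μ.canonicalPrice A ≤ μ.canonicalPrice B := by
  refine iSup_mono fun x => ?_
  rw [EReal.coe_le_coe_iff]
  gcongr

variable {μ}

/-- Incentive compatibility says exactly that the supremum defining this price is attained at `x`.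
-/
lemma IsDeterministic.canonicalPrice_bought (hd : μ.IsDeterministic) (x : Fin k → ℝ≥0) :
    μ.canonicalPrice (μ.bought x) = (μ.s x : ℝ) := by
  refine le_antisymm (iSup_le fun y => ?_) ?_
  · rw [EReal.coe_le_coe_iff]
    have := μ.ic y x
    rw [hd.sum_q x y] at this
    simp only [payoff]
    linarith
  · refine le_trans (le_of_eq ?_) (μ.le_canonicalPrice _ x)
    rw [EReal.coe_eq_coe_iff, payoff, hd.sum_q x x]
    ring

variable (μ) in
/-- The canonical price of the first `j` goods, with the junk value `0` if it is infinite. -/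
noncomputable def sizePrice (j : ℕ) : ℝ :=
  (μ.canonicalPrice (Finset.univ.filter fun i : Fin k => (i : ℕ) < j)).toReal

lemma sizePrice_nonneg (j : ℕ) : 0 ≤ μ.sizePrice j :=
  EReal.toReal_nonneg (μ.canonicalPrice_nonneg _)

lemma sizePrice_zero : μ.sizePrice 0 = 0 := by
  simp [sizePrice, canonicalPrice_empty]

lemma IsSymmetric.sizePrice_card (hs : μ.IsSymmetric) (A : Finset (Fin k)) :
    μ.sizePrice A.card = (μ.canonicalPrice A).toReal := by
  have hA : A.card ≤ k := by simpa using A.card_le_univ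
  rw [sizePrice, hs _ A]
  rw [Fin.card_filter_val_lt]
  exact min_eq_right hA

lemma IsDeterministic.canonicalPrice_ne_top (hd : μ.IsDeterministic) (x : Fin k → ℝ≥0)
    {A : Finset (Fin k)} (hA : A ⊆ μ.bought x) : μ.canonicalPrice A ≠ ⊤ := by
  have h := μ.canonicalPrice_mono hA
  rw [hd.canonicalPrice_bought] at h
  exact ne_top_of_le_ne_top (EReal.coe_ne_top _) h

/-- The pointwise bound of the payment by truncated order statistics. -/
lemma ofReal_s_le (hd : μ.IsDeterministic) (hs : μ.IsSymmetric) (x : Fin k → ℝ≥0) :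
    ENNReal.ofReal (μ.s x) ≤ ∑ j ∈ Finset.range k,
      2 * volume (Set.Ioc (μ.sizePrice (j + 1) / (2 * k)) (μ.sizePrice (j + 1)) ∩
        {t | j + 1 ≤ demand t x}) := by
  set A := μ.bought x with hA
  set m := A.card with hm
  obtain ⟨e, he, heA, hanti⟩ : ∃ e : Fin m → Fin k, Function.Injective e ∧ (∀ i, e i ∈ A) ∧
      Antitone fun i => x (e i) := exists_antitone_enum x A
  have hmk : m ≤ k := by simpa using A.card_le_univ
  let y : ℕ → ℝ := fun i => if h : i < m then (x (e ⟨i, h⟩) : ℝ) else 0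
  -- For `j ≤ m`, the `j` most valuable goods among those bought. Their prices are finite, being at
  -- most the payment.
  let B : ℕ → Finset (Fin k) := fun j => (Finset.univ.filter fun i : Fin m => (i : ℕ) < j).image e
  have hBA : ∀ j, B j ⊆ A := fun j => by
    intro i hi
    obtain ⟨l, -, rfl⟩ := Finset.mem_image.1 hi
    exact heA l
  have hBcard : ∀ j ≤ m, (B j).card = j := fun j hj => by
    rw [Finset.card_image_of_injective _ he, Fin.card_filter_val_lt, min_eq_right hj]
  have hBsum : ∀ j ≤ m, ∑ i ∈ B j, (x i : ℝ) = ∑ i ∈ Finset.range j, y i := fun j hj => by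
    rw [Finset.sum_image he.injOn]
    symm
    refine Finset.sum_bij' (fun i hi => ⟨i, (Finset.mem_range.1 hi).trans_le hj⟩)
      (fun i _ => (i : ℕ)) ?_ ?_ ?_ ?_ ?_ <;> simp +contextual [y]
    intro i hi
    rw [dif_pos (hi.trans_le hj)]
  have hBm : B m = A := Finset.eq_of_subset_of_card_le (hBA m) (hBcard m le_rfl).ge
  have hcoe : ∀ j ≤ m, μ.canonicalPrice (B j) = (μ.sizePrice j : ℝ) := fun j hj => by
    have h := hs.sizePrice_card (B j)
    rw [hBcard j hj] at h
    rw [h, EReal.coe_toReal (hd.canonicalPrice_ne_top x (hBA j))]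
    exact ne_bot_of_le_ne_bot EReal.zero_ne_bot (μ.canonicalPrice_nonneg _)
  have hpm : μ.sizePrice m = μ.s x := by
    have h := hcoe m le_rfl
    rw [hBm, hd.canonicalPrice_bought, EReal.coe_eq_coe_iff] at h
    exact h.symm
  have hmono : ∀ j ≤ m, μ.sizePrice j ≤ μ.s x := fun j hj => by
    have h := μ.canonicalPrice_mono (hBA j)
    rw [hcoe j hj, hd.canonicalPrice_bought, EReal.coe_le_coe_iff] at h
    exact h
  have htail : ∀ j ≤ m, μ.sizePrice m - μ.sizePrice j ≤ ∑ i ∈ Finset.Ico j m, y i := by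
    intro j hj
    have h := μ.le_canonicalPrice (B j) x
    rw [hcoe j hj, EReal.coe_le_coe_iff, hBsum j hj, payoff, hd.sum_q x x, ← hA, ← hBm,
      hBsum m le_rfl] at h
    rw [Finset.sum_Ico_eq_sub _ hj, hpm]
    linarith
  have hy0 : ∀ i, 0 ≤ y i := fun i => by
    simp only [y]; split_ifs <;> simp
  have hmin := le_sum_min μ.sizePrice y m sizePrice_zero hy0 htail fun j _ => sizePrice_nonneg j
  have hdem : ∀ i < m, ∀ t ≤ y i, i + 1 ≤ demand t x := fun i hi t ht => by
    rw [← hBcard (i + 1) hi]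
    refine Finset.card_le_card fun l hl => ?_
    obtain ⟨l, hl', rfl⟩ := Finset.mem_image.1 hl
    simp only [Finset.mem_filter, Finset.mem_univ, true_and] at hl' ⊢
    simp only [y, hi, dif_pos] at ht
    exact ht.trans (NNReal.coe_le_coe.2 (hanti (show l ≤ ⟨i, hi⟩ from Nat.lt_succ_iff.1 hl')))
  -- There are at most `k` subtracted terms, each at most `s x / (2k)`, so half of the payment
  -- survives; the factor `2` restores it. Individual terms may be negative.
  have hreal : μ.s x ≤ ∑ i ∈ Finset.range m,
      2 * (min (y i) (μ.sizePrice (i + 1)) - μ.sizePrice (i + 1) / (2 * k)) := by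
    have h1 : ∑ i ∈ Finset.range m, μ.sizePrice (i + 1) / (2 * k) ≤ μ.s x / 2 := by
      rcases Nat.eq_zero_or_pos k with rfl | hk
      · simpa using div_nonneg (μ.npt x) zero_le_two
      have hk' : (0 : ℝ) < k := by exact_mod_cast hk
      calc ∑ i ∈ Finset.range m, μ.sizePrice (i + 1) / (2 * k)
          ≤ ∑ i ∈ Finset.range m, μ.s x / (2 * k) := by
            refine Finset.sum_le_sum fun i hi => ?_
            gcongr
            exact hmono _ (Finset.mem_range.1 hi)
        _ = m * (μ.s x / (2 * k)) := by simp
        _ ≤ k * (μ.s x / (2 * k)) := by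
            have := μ.npt x
            gcongr
        _ = μ.s x / 2 := by field_simp
    rw [← Finset.mul_sum, Finset.sum_sub_distrib]
    linarith
  calc ENNReal.ofReal (μ.s x)
      ≤ ∑ i ∈ Finset.range m, ENNReal.ofReal
          (2 * (min (y i) (μ.sizePrice (i + 1)) - μ.sizePrice (i + 1) / (2 * k))) :=
        (ENNReal.ofReal_le_ofReal hreal).trans (ofReal_sum_le _ _)
    _ ≤ ∑ j ∈ Finset.range m,
          2 * volume (Set.Ioc (μ.sizePrice (j + 1) / (2 * k)) (μ.sizePrice (j + 1)) ∩
            {t | j + 1 ≤ demand t x}) := by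
        refine Finset.sum_le_sum fun i hi => ?_
        rw [ENNReal.ofReal_mul zero_le_two, ENNReal.ofReal_ofNat, ← Real.volume_Ioc]
        gcongr
        intro t ht
        exact ⟨⟨ht.1, ht.2.trans (min_le_right _ _)⟩,
          hdem i (Finset.mem_range.1 hi) t (ht.2.trans (min_le_left _ _))⟩
    -- Extending to all `j < k` removes the dependence of the range on `x`. Sizes of infinite price
    -- have the default `0`, so their intervals are empty.
    _ ≤ _ := Finset.sum_le_sum_of_subset (Finset.range_mono hmk)

end Mechanism

/-! ### Integration of the pointwise bound, comparison with `sRev`, and growth of the constant. -/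

lemma symDRev_le {k : ℕ} (hk : 1 ≤ k) {Ω : Type*} [MeasurableSpace Ω] (P : Measure Ω) [SFinite P]
    (X : Ω → Fin k → ℝ≥0) (hX : Measurable X) :
    symDRev P X ≤
      ENNReal.ofReal (2 * Real.log (2 * k) * (harmonic k : ℝ)) * symSRev P X := by
  refine iSup₂_le fun μ hμ => ?_
  have hk' : (1 : ℝ) ≤ k := by exact_mod_cast hk
  have hlog : 0 ≤ Real.log (2 * k) := Real.log_nonneg (by linarith)
  have hmeas : ∀ j : ℕ, Measurable fun ω =>
      2 * volume (Set.Ioc (μ.sizePrice (j + 1) / (2 * k)) (μ.sizePrice (j + 1)) ∩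
        {t | j + 1 ≤ demand t (X ω)}) := fun j => by
    have hS : MeasurableSet {z : Ω × ℝ |
        z.2 ∈ Set.Ioc (μ.sizePrice (j + 1) / (2 * k)) (μ.sizePrice (j + 1)) ∧
          j + 1 ≤ demand z.2 (X z.1)} :=
      (measurable_snd measurableSet_Ioc).inter (measurableSet_le measurable_const
        (measurable_demand.comp ((hX.comp measurable_fst).prodMk measurable_snd)))
    exact (measurable_measure_prodMk_left hS).const_mul 2
  calc μ.revenue P X
      ≤ ∫⁻ ω, ∑ j ∈ Finset.range k,
          2 * volume (Set.Ioc (μ.sizePrice (j + 1) / (2 * k)) (μ.sizePrice (j + 1)) ∩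
            {t | j + 1 ≤ demand t (X ω)}) ∂P :=
        lintegral_mono fun ω => Mechanism.ofReal_s_le hμ.1 hμ.2 (X ω)
    _ = ∑ j ∈ Finset.range k, 2 * ∫⁻ ω,
          volume (Set.Ioc (μ.sizePrice (j + 1) / (2 * k)) (μ.sizePrice (j + 1)) ∩
            {t | j + 1 ≤ demand t (X ω)}) ∂P := by
        rw [lintegral_finsetSum _ fun j _ => hmeas j]
        refine Finset.sum_congr rfl fun j _ => ?_
        rw [lintegral_const_mul' _ _ ENNReal.ofNat_ne_top]
    _ ≤ ∑ j ∈ Finset.range k, 2 * (ENNReal.ofReal (Real.log (2 * k)) *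
          (ENNReal.ofReal ((j + 1 : ℝ)⁻¹) * symSRev P X)) := by
        gcongr with j
        exact lintegral_lintegral_demand_le hX j _ _ (Mechanism.sizePrice_nonneg _) (by linarith)
    _ = _ := by
        rw [← Finset.mul_sum, ← Finset.mul_sum, ← Finset.sum_mul,
          ENNReal.ofReal_mul (by positivity), ENNReal.ofReal_mul zero_le_two, ENNReal.ofReal_ofNat,
          harmonic]
        push_cast
        rw [ENNReal.ofReal_sum_of_nonneg fun j _ => by positivity]
        ring

lemma symSRev_le_sRev {k : ℕ} {Ω : Type*} [MeasurableSpace Ω] (P : Measure Ω)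
    (X : Ω → Fin k → ℝ≥0) (hX : Measurable X) : symSRev P X ≤ sRev P X := by
  refine iSup₂_le fun μ hμ => ?_
  obtain ⟨ν, hν⟩ := hμ
  calc μ.revenue P X = ∫⁻ ω, ∑ i, ENNReal.ofReal (ν.s fun _ => X ω i) ∂P := by
        refine lintegral_congr fun ω => ?_
        rw [(hν _).2, ENNReal.ofReal_sum_of_nonneg fun i _ => ν.npt _]
    _ = ∑ i, ν.revenue P (fun ω (_ : Fin 1) => X ω i) := by
        refine lintegral_finsetSum _ fun i _ => ENNReal.measurable_ofReal.comp ?_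
        exact ν.measurable_s.comp (measurable_pi_lambda _ fun _ => (measurable_pi_apply i).comp hX)
    _ ≤ sRev P X := Finset.sum_le_sum fun i _ =>
        le_iSup₂ (f := fun (ν : Mechanism 1) (_ : ν ∈ Set.univ) =>
          ν.revenue P (fun ω (_ : Fin 1) => X ω i)) ν (Set.mem_univ _)

lemma log_two_mul_mul_harmonic_isBigO :
    (fun k : ℕ => 2 * Real.log (2 * k) * (harmonic k : ℝ)) =O[Filter.atTop]
      fun k : ℕ => Real.log k ^ 2 := by
  refine Asymptotics.IsBigO.of_bound 8 ?_
  filter_upwards [Filter.eventually_ge_atTop 3] with k hk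
  have hk' : (3 : ℝ) ≤ k := by exact_mod_cast hk
  -- Since `3 > e`, `log k` absorbs both `log 2` and the `1` in `H(k) ≤ 1 + log k`, each at the cost
  -- of a factor `2`.
  have h1 : 1 ≤ Real.log k := by
    rw [Real.le_log_iff_exp_le (by linarith)]
    linarith [Real.exp_one_lt_d9]
  have h2 : Real.log (2 * k) ≤ 2 * Real.log k := by
    rw [Real.log_mul two_ne_zero (by linarith)]
    linarith [Real.log_two_lt_d9]
  have h3 := harmonic_le_one_add_log k
  have h4 : (0 : ℝ) ≤ harmonic k := by
    simp only [harmonic]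
    push_cast
    positivity
  have h5 : 0 ≤ Real.log (2 * k) := Real.log_nonneg (by linarith)
  rw [Real.norm_of_nonneg (by positivity), Real.norm_of_nonneg (by positivity)]
  calc 2 * Real.log (2 * k) * (harmonic k : ℝ)
      ≤ 2 * (2 * Real.log k) * (2 * Real.log k) := by gcongr; linarith
    _ = 8 * Real.log k ^ 2 := by ring

end Pricing

theorem theoremE :
    (∀ (k : ℕ), 1 ≤ k → ∀ (Ω : Type*) [MeasurableSpace Ω] (P : Measure Ω) [IsProbabilityMeasure P]
      (X : Ω → Fin k → ℝ≥0), Measurable X →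
      Pricing.symDRev P X ≤
        ENNReal.ofReal (2 * Real.log (2 * k) * (harmonic k : ℝ)) * Pricing.symSRev P X) ∧
    ∃ f : ℕ → ℝ, f =O[Filter.atTop] (fun k : ℕ => Real.log k ^ 2) ∧
      ∀ (k : ℕ), 1 ≤ k → ∀ (Ω : Type*) [MeasurableSpace Ω] (P : Measure Ω) [IsProbabilityMeasure P]
        (X : Ω → Fin k → ℝ≥0), Measurable X →
        ENNReal.ofReal (2 * Real.log (2 * k) * (harmonic k : ℝ)) * Pricing.symSRev P X ≤
          ENNReal.ofReal (f k) * Pricing.sRev P X := by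
  exact ⟨fun k hk Ω _ P _ X hX => Pricing.symDRev_le hk P X hX,
    fun k => 2 * Real.log (2 * k) * (harmonic k : ℝ), Pricing.log_two_mul_mul_harmonic_isBigO,
    fun k _ Ω _ P _ X hX => mul_le_mul_right (Pricing.symSRev_le_sRev P X hX) _⟩
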